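/- Let $G=GL_2(\mathbb Z)\ltimes\mathbb Z^2$ act on $\mathbb R^2$ by $x\mapsto Ux+v$. Two regions are $G$-equivalent if some element of $G$ maps one onto the other. Sets $P,Q\subset\mathbb R^2$ are (rationally, finitely, discretely) \emph{equidecomposable} if there are finitely many open simplices $T_1,\dots,T_r$ (points, open segments or open triangles) with rational vertices and $g_1,\dots,g_r\in G$ such that $P=\bigsqcup_i T_i$ and $Q=\bigsqcup_i g_i(T_i)$ (disjoint unions). The Ehrhart function of a bounded set $S\subset\mathbb R^2$ is $\mathrm{ehr}_S(k)=|kS\cap\mathbb Z^2|$ for $k\in\mathbb N$. For a positive integer $d$, a nondegenerate triangle is \emph{$d$-minimal} if it meets $\frac1d\mathbb Z\times\frac1d\mathbb Z$ precisely in its vertices. If $\frac1d p,\frac1d q,\frac1d r$ (with $p,q,r\in\mathbb Z^2$) are the vertices of a $d$-minimal triangle $T$ in counterclockwise order, its \emph{weight} is the multiset $W_d(T)=\{\det(p,q),\det(q,r),\det(r,p)\}$ of residues modulo $d$. Two $d$-minimal triangles $T_l,T_r$ are \emph{similar neighbors} with parameter $t\in\mathbb Z$ if $1+t$, $2+t$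 and $d$ are pairwise coprime, $3+2t\not\equiv 0 \pmod d$, and $T_l$, $T_r$ are $G$-equivalent, respectively, to $$\mathrm{Conv}\left(\left(\tfrac{1+t}{d},\tfrac1d\right),\left(\tfrac{1+t}{d},0\right),\left(\tfrac td,\tfrac1d\right)\right)\quad\text{and}\quad \mathrm{Conv}\left(\left(\tfrac{2+t}{d},\tfrac1d\right),\left(\tfrac{2+t}{d},0\right),\left(\tfrac{1+t}{d},\tfrac1d\right)\right).$$ \textbf{Theorem.} Let $T_l,T_r$ be similar neighbors with denominator $d$ and parameter $t$. Then they have the same Ehrhart quasi-polynomial: $\mathrm{ehr}_{T_l}(k)=\mathrm{ehr}_{T_r}(k)$ for all $k\in\mathbb N$, and this function of $k$ is a quasi-polynomial with period $d$ (on each residue class modulo $d$ it agrees with a polynomial, and these polynomials all have the same degree). Their weights are $W_d(T_l)=\{1+t,1,-1-t\}$ and $W_d(T_r)=\{2+t,1,-2-t\}$, and these multisets of residues modulo $d$ are different. The triangles $T_l$ and $T_r$ are not equidecomposable. Moreover, similar neighbors form an infinite family: they exist for infinitely many $d$. -/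

import Mathlib

namespace DiscreteEquidecomp

/-- The plane `ℝ²`. -/
abbrev Plane : Type := Fin 2 → ℝ

/-- The map `x ↦ U x + v` of the plane, for `U ∈ GL₂(ℤ)` and `v ∈ ℤ²`. -/
def affineUnimodular (U : GL (Fin 2) ℤ) (v : Fin 2 → ℤ) (x : Plane) : Plane :=
  (U.val.map (Int.cast : ℤ → ℝ)).mulVec x + fun i => (v i : ℝ)

/-- `g` is a `G`-map: it is induced by an element of `G = GL₂(ℤ) ⋊ ℤ²`. -/
def IsGMap (g : Plane → Plane) : Prop :=
  ∃ (U : GL (Fin 2) ℤ) (v : Fin 2 → ℤ), g = affineUnimodular U v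

/-- Two regions are `G`-equivalent if some `G`-map carries one onto the other. -/
def GEquivalent (R S : Set Plane) : Prop :=
  ∃ g : Plane → Plane, IsGMap g ∧ g '' R = S

/-- The open simplex spanned by an `n`-simplex: all convex combinations of the vertices with strictly
positive weights. For `n = 0` it is the vertex itself. -/
def openSimplex {n : ℕ} (s : Affine.Simplex ℝ Plane n) : Set Plane :=
  {x | ∃ w : Fin (n + 1) → ℝ, (∀ i, 0 < w i) ∧ ∑ i, w i = 1 ∧ x = ∑ i, w i • s.points i}

/-- `S` is an open simplex (a point, an open segment or an open triangle) all of whose vertices have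
rational coordinates. -/
def IsRationalOpenSimplex (S : Set Plane) : Prop :=
  ∃ (n : ℕ) (s : Affine.Simplex ℝ Plane n),
    (∀ i j, ∃ q : ℚ, s.points i j = (q : ℝ)) ∧ S = openSimplex s

/-- Rational finite discrete equidecomposability: `P` is a disjoint union of finitely many rational
open simplices `T i`, and `Q` is the disjoint union of their images `g i (T i)` under `G`-maps. -/
def Equidecomposable (P Q : Set Plane) : Prop :=
  ∃ (r : ℕ) (T : Fin r → Set Plane) (g : Fin r → Plane → Plane),
    (∀ i, IsRationalOpenSimplex (T i)) ∧ (∀ i, IsGMap (g i)) ∧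
    (Pairwise fun i j => Disjoint (T i) (T j)) ∧ ⋃ i, T i = P ∧
    (Pairwise fun i j => Disjoint (g i '' T i) (g j '' T j)) ∧ ⋃ i, g i '' T i = Q

/-- The Ehrhart function: the number of integer points in the `k`-th dilate of `S`. -/
noncomputable def ehr (S : Set Plane) (k : ℕ) : ℕ :=
  Set.ncard {z : Fin 2 → ℤ | (fun i => (z i : ℝ)) ∈ (fun x : Plane => (k : ℝ) • x) '' S}

/-- `f` is a quasi-polynomial with period `d`: on each residue class modulo `d` it agrees with a
polynomial (a constituent), and all constituents have the same degree. -/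
def IsQuasiPolynomial (d : ℕ) (f : ℕ → ℝ) : Prop :=
  0 < d ∧ ∃ q : ZMod d → Polynomial ℝ,
    (∀ i j, (q i).degree = (q j).degree) ∧ ∀ k : ℕ, f k = (q (k : ZMod d)).eval (k : ℝ)

/-- The point `(z₀ / d, z₁ / d)`. -/
noncomputable def latticePoint (d : ℕ) (z : Fin 2 → ℤ) : Plane := fun i => (z i : ℝ) / (d : ℝ)

/-- The lattice `(1/d)ℤ × (1/d)ℤ`. -/
def lattice (d : ℕ) : Set Plane := Set.range (latticePoint d)

/-- `T` is a `d`-minimal triangle: a nondegenerate triangle that meets `(1/d)ℤ × (1/d)ℤ` precisely in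
its vertices. -/
def IsMinimalTriangle (d : ℕ) (T : Set Plane) : Prop :=
  ∃ v : Fin 3 → Plane, AffineIndependent ℝ v ∧ T = convexHull ℝ (Set.range v) ∧
    T ∩ lattice d = Set.range v

/-- The weight modulo `d` of the oriented segment from `p / d` to `q / d`. -/
def edgeWeight (d : ℕ) (p q : Fin 2 → ℤ) : ZMod d :=
  ((Matrix.det !![p 0, q 0; p 1, q 1] : ℤ) : ZMod d)

/-- The multiset `W` is the weight of the triangle `T` with vertices in `(1/d)ℤ × (1/d)ℤ`: the
vertices, listed counterclockwise, are `p / d`, `q / d`, `r / d`, and `W` collects the weights of the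
three edges so oriented. -/
def HasWeight (d : ℕ) (T : Set Plane) (W : Multiset (ZMod d)) : Prop :=
  ∃ p q r : Fin 2 → ℤ,
    T = convexHull ℝ {latticePoint d p, latticePoint d q, latticePoint d r} ∧
    0 < Matrix.det !![q 0 - p 0, r 0 - p 0; q 1 - p 1, r 1 - p 1] ∧
    W = {edgeWeight d p q, edgeWeight d q r, edgeWeight d r p}

/-- The triangle `Conv(((1+t)/d, 1/d), ((1+t)/d, 0), (t/d, 1/d))`. -/
noncomputable def leftTriangle (d : ℕ) (t : ℤ) : Set Plane :=
  convexHull ℝ {![(1 + t : ℝ) / d, 1 / d], ![(1 + t : ℝ) / d, 0], ![(t : ℝ) / d, 1 / d]}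

/-- The triangle `Conv(((2+t)/d, 1/d), ((2+t)/d, 0), ((1+t)/d, 1/d))`. -/
noncomputable def rightTriangle (d : ℕ) (t : ℤ) : Set Plane :=
  convexHull ℝ {![(2 + t : ℝ) / d, 1 / d], ![(2 + t : ℝ) / d, 0], ![(1 + t : ℝ) / d, 1 / d]}

/-- The `d`-minimal triangles `Tl` and `Tr` are similar neighbors, with parameter `t`. -/
structure AreSimilarNeighbors (d : ℕ) (t : ℤ) (Tl Tr : Set Plane) : Prop where
  pos : 0 < d
  left_minimal : IsMinimalTriangle d Tl
  right_minimal : IsMinimalTriangle d Tr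
  left_equiv : GEquivalent Tl (leftTriangle d t)
  right_equiv : GEquivalent Tr (rightTriangle d t)
  coprime_left_right : IsCoprime (1 + t) (2 + t)
  coprime_left : IsCoprime (1 + t) (d : ℤ)
  coprime_right : IsCoprime (2 + t) (d : ℤ)
  not_zero_mod : ¬ (3 + 2 * t ≡ 0 [ZMOD (d : ℤ)])

end DiscreteEquidecomp

open DiscreteEquidecomp

/-! Up to a `G`-map both triangles are model triangles `cornerTriangle d s`, with s = 1 + t and s =
2 + t. If s is coprime to d, row y ≥ 0 of the k-th dilate (as long as dy ≤ k) contains y lattice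
points, or y + 1 if d divides k. So the Ehrhart function does not depend on s
(`ehr_cornerTriangle`).

Non-equidecomposability comes from an additive `G`-invariant, `flagSum`. A flag is a point z/d, a
primitive direction w and a side σ of w. The residue of σ·det(z, w) mod d is unchanged by `G`: U
multiplies both factors by det U, and a translation by v moves z by dv. So summing φ of this residue
times the jump of the set at the flag gives a `G`-invariant for every φ (`flagSum_image`). The sum
is additive because membership in a convex set is eventually constant along a ray, so tangent cones
commute with finite unions (`tangentCone_iUnion`), and because a bounded convex set jumps at only
finitely many primitive flags (`finite_flagTerm_support`). The denominators of the pieces play no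
role.

A model triangle jumps only along its edges, seen from either endpoint, so its sum is 2(φ(s) + φ(-s)
+ φ(-1)) (`flagSum_cornerTriangle`). Taking φ to be the indicator of s separates s from s' unless s'
= ±s mod d. For 1 + t and 2 + t these two cases would give 1 = 0 and 3 + 2t = 0 mod d, both
impossible by hypothesis. -/

namespace DiscreteEquidecomp
open Filter Topology

/-! ### Tangent cones of convex sets -/

section TangentCone
variable {E : Type*} [AddCommGroup E] [Module ℝ E]

/-- The directions in which one can leave `x` and stay in `S` for a short time. -/
def tangentCone (S : Set E) (x : E) : Set E := {w | ∀ᶠ ε in 𝓝[>] (0 : ℝ), x + ε • w ∈ S}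

theorem mem_tangentCone {S : Set E} {x w : E} :
    w ∈ tangentCone S x ↔ ∀ᶠ ε in 𝓝[>] (0 : ℝ), x + ε • w ∈ S := Iff.rfl

theorem tangentCone_mono {S S' : Set E} (h : S ⊆ S') (x : E) :
    tangentCone S x ⊆ tangentCone S' x :=
  fun _ hw => (mem_tangentCone.1 hw).mono fun _ h' => h h'

theorem convex_tangentCone {S : Set E} (hS : Convex ℝ S) (x : E) :
    Convex ℝ (tangentCone S x) := by
  intro w₁ h₁ w₂ h₂ a b ha hb hab
  rw [mem_tangentCone] at *
  filter_upwards [h₁, h₂] with ε e₁ e₂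
  have := hS e₁ e₂ ha hb hab
  convert this using 1
  have hx : x = (a + b) • x := by rw [hab, one_smul]
  nth_rewrite 1 [hx]
  module

/-- A ray meets a convex set in an interval. If the ray returned to S arbitrarily close to x,
convexity would fill in all short times. -/
theorem eventually_notMem_of_notMem_tangentCone {S : Set E} (hS : Convex ℝ S) {x w : E}
    (h : w ∉ tangentCone S x) : ∀ᶠ ε in 𝓝[>] (0 : ℝ), x + ε • w ∉ S := by
  by_contra h'
  apply h
  have hex : ∀ a > (0 : ℝ), ∃ ε, 0 < ε ∧ ε < a ∧ x + ε • w ∈ S := by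
    intro a ha
    have := (Filter.not_eventually.1 h').and_eventually (Ioo_mem_nhdsGT ha)
    obtain ⟨ε, h1, h2⟩ := this.exists
    exact ⟨ε, h2.1, h2.2, not_not.1 h1⟩
  obtain ⟨b, hb, -, hbS⟩ := hex 1 one_pos
  filter_upwards [Ioo_mem_nhdsGT hb] with ε hε
  obtain ⟨a, ha, haε, haS⟩ := hex ε hε.1
  have hab : 0 < b - a := by linarith [hε.2]
  have := hS haS hbS (a := (b - ε) / (b - a)) (b := (ε - a) / (b - a))
    (div_nonneg (by linarith [hε.2]) hab.le) (div_nonneg (by linarith) hab.le)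
    (by rw [← add_div, div_eq_one_iff_eq hab.ne']; ring)
  convert this using 1
  have e1 : (b - ε) / (b - a) + (ε - a) / (b - a) = 1 := by
    rw [← add_div, div_eq_one_iff_eq hab.ne']; ring
  have e2 : (b - ε) / (b - a) * a + (ε - a) / (b - a) * b = ε := by
    field_simp; ring
  calc x + ε • w = ((b - ε) / (b - a) + (ε - a) / (b - a)) • x
        + ((b - ε) / (b - a) * a + (ε - a) / (b - a) * b) • w := by rw [e1, e2, one_smul]
    _ = _ := by module

/-- A ray that is not eventually in any one piece eventually avoids each of the finitely many
pieces, hence their union. This is the source of additivity. -/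
theorem tangentCone_iUnion {ι : Type*} [Finite ι] {S : ι → Set E} (hS : ∀ i, Convex ℝ (S i))
    (x : E) : tangentCone (⋃ i, S i) x = ⋃ i, tangentCone (S i) x := by
  ext w
  constructor
  · intro hw
    by_contra hn
    simp only [Set.mem_iUnion, not_exists] at hn
    have h1 : ∀ᶠ ε in 𝓝[>] (0 : ℝ), ∀ i, x + ε • w ∉ S i :=
      Filter.eventually_all.2 fun i => eventually_notMem_of_notMem_tangentCone (hS i) (hn i)
    obtain ⟨ε, h2, h3⟩ := (h1.and hw).exists
    obtain ⟨i, hi⟩ := Set.mem_iUnion.1 h3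
    exact h2 i hi
  · intro hw
    obtain ⟨i, hi⟩ := Set.mem_iUnion.1 hw
    exact tangentCone_mono (Set.subset_iUnion S i) x hi

theorem disjoint_tangentCone {S S' : Set E} (h : Disjoint S S') (x : E) :
    Disjoint (tangentCone S x) (tangentCone S' x) := by
  rw [Set.disjoint_left]
  intro w h1 h2
  obtain ⟨ε, h3, h4⟩ := ((mem_tangentCone.1 h1).and (mem_tangentCone.1 h2)).exists
  exact Set.disjoint_left.1 h h3 h4

theorem smul_mem_tangentCone {S : Set E} {x w : E} {c : ℝ} (hc : 0 < c)
    (hw : w ∈ tangentCone S x) : c • w ∈ tangentCone S x := by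
  have ht : Tendsto (fun ε : ℝ => ε * c) (𝓝[>] 0) (𝓝[>] 0) := by
    refine tendsto_nhdsWithin_iff.2 ⟨?_, ?_⟩
    · have : Tendsto (fun ε : ℝ => ε * c) (𝓝 0) (𝓝 (0 * c)) :=
        (continuous_id.mul continuous_const).tendsto 0
      rw [zero_mul] at this
      exact this.mono_left nhdsWithin_le_nhds
    · filter_upwards [self_mem_nhdsWithin] with ε hε using mul_pos hε hc
  filter_upwards [ht.eventually hw] with ε hε
  rwa [smul_smul]

theorem add_mem_of_convex_cone {C : Set E} (hC : Convex ℝ C)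
    (hs : ∀ (c : ℝ) (w : E), 0 < c → w ∈ C → c • w ∈ C) {w₁ w₂ : E} (h₁ : w₁ ∈ C)
    (h₂ : w₂ ∈ C) : w₁ + w₂ ∈ C := by
  have := hs 2 _ two_pos (hC h₁ h₂ (a := 1 / 2) (b := 1 / 2) (by norm_num) (by norm_num)
    (by norm_num))
  convert this using 1
  module

/-- The second-order germ of a cone at `w` does not change when the transverse direction is
rescaled or moved along `w`. -/
theorem transverse_mem_tangentCone {C : Set E}
    (hs : ∀ (c : ℝ) (w : E), 0 < c → w ∈ C → c • w ∈ C) {w w' : E}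
    (h : w' ∈ tangentCone C w) {α : ℝ} (β : ℝ) (hα : 0 < α) :
    α • w' + β • w ∈ tangentCone C w := by
  have hpos : ∀ᶠ δ in 𝓝[>] (0 : ℝ), 0 < 1 + δ * β := by
    have : Tendsto (fun δ : ℝ => 1 + δ * β) (𝓝 0) (𝓝 (1 + 0 * β)) :=
      (continuous_const.add (continuous_id.mul continuous_const)).tendsto 0
    exact (this.mono_left nhdsWithin_le_nhds).eventually (lt_mem_nhds (by norm_num))
  -- w + δ(αw' + βw) = (1 + δβ)(w + (δα / (1 + δβ))w').
  have ht : Tendsto (fun δ : ℝ => δ * α / (1 + δ * β)) (𝓝[>] 0) (𝓝[>] 0) := by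
    refine tendsto_nhdsWithin_iff.2 ⟨?_, ?_⟩
    · have : ContinuousAt (fun δ : ℝ => δ * α / (1 + δ * β)) 0 :=
        ContinuousAt.div (by fun_prop) (by fun_prop) (by norm_num)
      have := this.tendsto
      rw [zero_mul, zero_div] at this
      exact this.mono_left nhdsWithin_le_nhds
    · filter_upwards [self_mem_nhdsWithin, hpos] with δ hδ hp using div_pos (mul_pos hδ hα) hp
  filter_upwards [ht.eventually h, hpos] with δ hδ hp
  have := hs _ _ hp hδ
  convert this using 1
  rw [smul_add (1 + δ * β), smul_smul (1 + δ * β), mul_div_cancel₀ _ hp.ne']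
  module

theorem mem_tangentCone_of_mem {C : Set E} (hC : Convex ℝ C)
    (hs : ∀ (c : ℝ) (w : E), 0 < c → w ∈ C → c • w ∈ C) {w w' : E} (hw : w ∈ C)
    (hw' : w' ∈ C) : w' ∈ tangentCone C w := by
  filter_upwards [self_mem_nhdsWithin] with δ hδ
  exact add_mem_of_convex_cone hC hs hw (hs _ _ hδ hw')

theorem tangentCone_image {F : Type*} [AddCommGroup F] [Module ℝ F] (L : E ≃ₗ[ℝ] F)
    (v : F) (S : Set E) (x : E) :
    tangentCone ((fun y => L y + v) '' S) (L x + v) = L '' tangentCone S x := by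
  have hinj : Function.Injective fun y => L y + v := fun a b h => L.injective (by simpa using h)
  ext w
  obtain ⟨w, rfl⟩ := L.surjective w
  rw [L.injective.mem_set_image, mem_tangentCone, mem_tangentCone]
  refine eventually_congr (Eventually.of_forall fun ε => ?_)
  rw [← hinj.mem_set_image (s := S)]
  simp only [map_add, map_smul]
  rw [add_right_comm]

end TangentCone

theorem mem_closure_of_mem_tangentCone {S : Set Plane} {x w : Plane} (h : w ∈ tangentCone S x) :
    x ∈ closure S := by
  have ht : Tendsto (fun ε : ℝ => x + ε • w) (𝓝[>] 0) (𝓝 x) := by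
    have : Tendsto (fun ε : ℝ => x + ε • w) (𝓝 0) (𝓝 (x + (0 : ℝ) • w)) :=
      Continuous.tendsto (by fun_prop) 0
    rw [zero_smul, add_zero] at this
    exact this.mono_left nhdsWithin_le_nhds
  exact mem_closure_of_tendsto ht h

theorem eventually_add_mul_nonpos_iff (a b : ℝ) :
    (∀ᶠ ε in 𝓝[>] (0 : ℝ), a + ε * b ≤ 0) ↔ a < 0 ∨ a = 0 ∧ b ≤ 0 := by
  have ht : Tendsto (fun ε : ℝ => a + ε * b) (𝓝[>] 0) (𝓝 a) := by
    have : Tendsto (fun ε : ℝ => a + ε * b) (𝓝 0) (𝓝 (a + 0 * b)) :=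
      Continuous.tendsto (by fun_prop) 0
    rw [zero_mul, add_zero] at this
    exact this.mono_left nhdsWithin_le_nhds
  constructor
  · intro h
    rcases (le_of_tendsto ht h).lt_or_eq with h0 | h0
    · exact Or.inl h0
    · refine Or.inr ⟨h0, ?_⟩
      obtain ⟨ε, h1, h2⟩ := (h.and self_mem_nhdsWithin).exists
      rw [h0, zero_add] at h1
      exact nonpos_of_mul_nonpos_right h1 h2
  · rintro (h | ⟨h, hb⟩)
    · exact (ht.eventually (gt_mem_nhds h)).mono fun _ h => le_of_lt h
    · filter_upwards [self_mem_nhdsWithin] with ε hε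
      rw [h, zero_add]
      exact mul_nonpos_of_nonneg_of_nonpos (le_of_lt hε) hb

/-! ### Determinants, integer vectors and `G`-maps -/

/-- The determinant of the pair `x, y`. -/
def cross {R : Type*} [CommRing R] (x y : Fin 2 → R) : R := x 0 * y 1 - x 1 * y 0

theorem cross_mulVec {R : Type*} [CommRing R] (M : Matrix (Fin 2) (Fin 2) R) (x y : Fin 2 → R) :
    cross (M.mulVec x) (M.mulVec y) = M.det * cross x y := by
  simp only [cross, Matrix.mulVec, dotProduct, Fin.sum_univ_two, Matrix.det_fin_two]
  ring

/-- An integer vector as a vector of the plane. -/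
def toPlane (z : Fin 2 → ℤ) : Plane := fun i => (z i : ℝ)

theorem toPlane_neg (z : Fin 2 → ℤ) : toPlane (-z) = -toPlane z := by
  ext i; simp [toPlane]

theorem cross_toPlane (z w : Fin 2 → ℤ) : cross (toPlane z) (toPlane w) = (cross z w : ℤ) := by
  simp [cross, toPlane]

theorem toPlane_mulVec (M : Matrix (Fin 2) (Fin 2) ℤ) (z : Fin 2 → ℤ) :
    toPlane (M.mulVec z) = (M.map (Int.cast : ℤ → ℝ)).mulVec (toPlane z) := by
  ext i
  simp [toPlane, Matrix.mulVec, dotProduct]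

theorem affineUnimodular_latticePoint {d : ℕ} (hd : 0 < d) (U : GL (Fin 2) ℤ) (v z : Fin 2 → ℤ) :
    affineUnimodular U v (latticePoint d z) = latticePoint d (U.val.mulVec z + (d : ℤ) • v) := by
  have : (d : ℝ) ≠ 0 := by positivity
  ext i
  fin_cases i <;> simp [affineUnimodular, latticePoint] <;> field_simp

theorem inv_mulVec_mulVec (U : GL (Fin 2) ℤ) (z : Fin 2 → ℤ) :
    (U⁻¹).val.mulVec (U.val.mulVec z) = z := by
  rw [Matrix.mulVec_mulVec, ← Units.val_mul, inv_mul_cancel, Units.val_one, Matrix.one_mulVec]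

theorem mulVec_inv_mulVec (U : GL (Fin 2) ℤ) (z : Fin 2 → ℤ) :
    U.val.mulVec ((U⁻¹).val.mulVec z) = z := by
  rw [Matrix.mulVec_mulVec, ← Units.val_mul, mul_inv_cancel, Units.val_one, Matrix.one_mulVec]

theorem map_inv_mul_map (U : GL (Fin 2) ℤ) :
    (U⁻¹).val.map (Int.cast : ℤ → ℝ) * U.val.map (Int.cast : ℤ → ℝ) = 1 := by
  have h : (U⁻¹).val * U.val = 1 := by rw [← Units.val_mul, inv_mul_cancel, Units.val_one]
  have := congrArg (Int.castRingHom ℝ).mapMatrix h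
  rw [map_mul, map_one] at this
  exact this

theorem map_mul_map_inv (U : GL (Fin 2) ℤ) :
    U.val.map (Int.cast : ℤ → ℝ) * (U⁻¹).val.map (Int.cast : ℤ → ℝ) = 1 := by
  simpa using map_inv_mul_map U⁻¹

/-- The linear part of a `G`-map. -/
noncomputable def linearPart (U : GL (Fin 2) ℤ) : Plane ≃ₗ[ℝ] Plane :=
  Matrix.toLin'OfInv (map_inv_mul_map U) (map_mul_map_inv U)

theorem linearPart_apply (U : GL (Fin 2) ℤ) (x : Plane) :
    linearPart U x = (U.val.map (Int.cast : ℤ → ℝ)).mulVec x := by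
  simp [linearPart, Matrix.toLin'OfInv]

theorem affineUnimodular_eq (U : GL (Fin 2) ℤ) (v : Fin 2 → ℤ) :
    affineUnimodular U v = fun x => linearPart U x + toPlane v := by
  ext1 x
  rw [linearPart_apply]
  rfl

theorem det_val (U : GL (Fin 2) ℤ) :
    U.val.det = ((Matrix.GeneralLinearGroup.det U : ℤˣ) : ℤ) := rfl

/-! ### Flags and their jumps -/

/-- A lattice point (up to scaling), a direction and a choice of side of this direction. -/
abbrev Flag : Type := (Fin 2 → ℤ) × (Fin 2 → ℤ) × ℤˣ

/-- A vector on the side `σ` of `w`. -/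
def transverse (w : Fin 2 → ℤ) (σ : ℤˣ) : Plane := ((σ : ℤ) : ℝ) • ![-(w 1 : ℝ), (w 0 : ℝ)]

/-- The change of the germ of the indicator function of `S` at the given lattice point when the
given direction is tilted slightly to the given side. -/
noncomputable def flagJump (d : ℕ) (S : Set Plane) (a : Flag) : ℤ :=
  (tangentCone S (latticePoint d a.1)).indicator 1 (toPlane a.2.1) -
    (tangentCone (tangentCone S (latticePoint d a.1)) (toPlane a.2.1)).indicator 1
      (transverse a.2.1 a.2.2)

open Classical in
/-- The contribution of a flag to `flagSum`. -/
noncomputable def flagTerm (d : ℕ) (φ : ZMod d → ℤ) (S : Set Plane) (a : Flag) : ℤ :=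
  if IsCoprime (a.2.1 0) (a.2.1 1) then
    φ (((a.2.2 : ℤ) * cross a.1 a.2.1 : ℤ) : ZMod d) * flagJump d S a else 0

/-- The sum of the jumps of `S` over all primitive flags, each one weighted by `φ` of its weight. -/
noncomputable def flagSum (d : ℕ) (φ : ZMod d → ℤ) (S : Set Plane) : ℤ :=
  ∑ᶠ a, flagTerm d φ S a

theorem flagJump_iUnion {ι : Type*} [Fintype ι] {S : ι → Set Plane} (hS : ∀ i, Convex ℝ (S i))
    (hd : Pairwise fun i j => Disjoint (S i) (S j)) (d : ℕ) (a : Flag) :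
    flagJump d (⋃ i, S i) a = ∑ i, flagJump d (S i) a := by
  have key : ∀ (C : ι → Set Plane) (x : Plane), (Pairwise fun i j => Disjoint (C i) (C j)) →
      (⋃ i, C i).indicator (1 : Plane → ℤ) x = ∑ i, (C i).indicator 1 x := by
    intro C x hC
    have := Finset.indicator_biUnion_apply Finset.univ C (f := (1 : Plane → ℤ))
      (fun i _ j _ hij => hC hij) x
    simpa using this
  -- The tangent cones of the pieces are again convex and disjoint, so the argument can be iterated
  -- for the second-order germ.
  have h1 : Pairwise fun i j => Disjoint (tangentCone (S i) (latticePoint d a.1))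
      (tangentCone (S j) (latticePoint d a.1)) := fun i j hij => disjoint_tangentCone (hd hij) _
  rw [flagJump, tangentCone_iUnion hS, key _ _ h1,
    tangentCone_iUnion (fun i => convex_tangentCone (hS i) _),
    key _ _ (fun i j hij => disjoint_tangentCone (h1 hij) _), ← Finset.sum_sub_distrib]
  rfl

theorem flagTerm_iUnion {ι : Type*} [Fintype ι] {S : ι → Set Plane} (hS : ∀ i, Convex ℝ (S i))
    (hd : Pairwise fun i j => Disjoint (S i) (S j)) (d : ℕ) (φ : ZMod d → ℤ) (a : Flag) :
    flagTerm d φ (⋃ i, S i) a = ∑ i, flagTerm d φ (S i) a := by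
  unfold flagTerm
  split_ifs
  · rw [flagJump_iUnion hS hd, Finset.mul_sum]
  · simp

theorem eq_or_eq_neg_of_cross_eq_zero {w w' : Fin 2 → ℤ} (h : IsCoprime (w 0) (w 1))
    (h' : IsCoprime (w' 0) (w' 1)) (hc : cross w w' = 0) : w' = w ∨ w' = -w := by
  obtain ⟨a, b, hab⟩ := h
  obtain ⟨a', b', hab'⟩ := h'
  unfold cross at hc
  have h0 : w' 0 = (a * w' 0 + b * w' 1) * w 0 := by linear_combination -w' 0 * hab - b * hc
  have h1 : w' 1 = (a * w' 0 + b * w' 1) * w 1 := by linear_combination -w' 1 * hab + a * hc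
  set k := a * w' 0 + b * w' 1
  have hk : IsUnit k := IsUnit.of_mul_eq_one (a' * w 0 + b' * w 1) (by
    rw [h0, h1] at hab'; linear_combination hab')
  rcases Int.isUnit_iff.1 hk with hk | hk <;> rw [hk] at h0 h1
  · left; ext i; fin_cases i <;> simp [h0, h1]
  · right; ext i; fin_cases i <;> simp [h0, h1]

theorem finite_of_cross_eq_zero {M : Set (Fin 2 → ℤ)} (h : ∀ w ∈ M, IsCoprime (w 0) (w 1))
    (hc : ∀ w ∈ M, ∀ w' ∈ M, cross w w' = 0) : M.Finite := by
  rcases M.eq_empty_or_nonempty with rfl | ⟨w, hw⟩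
  · exact Set.finite_empty
  · refine (Set.toFinite {w, -w}).subset fun w' hw' => ?_
    exact eq_or_eq_neg_of_cross_eq_zero (h w hw) (h w' hw') (hc w hw w' hw')

/-- Only the side of w matters: u is a positive multiple of the transverse vector plus a multiple of
w, which does not affect the germ of a cone at w. This is needed because `G` does not preserve
orthogonality. -/
theorem transverse_mem_iff {C : Set Plane}
    (hs : ∀ (c : ℝ) (w : Plane), 0 < c → w ∈ C → c • w ∈ C) {w : Fin 2 → ℤ} {σ : ℤˣ} {u : Plane}
    (hu : 0 < ((σ : ℤ) : ℝ) * cross (toPlane w) u) :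
    transverse w σ ∈ tangentCone C (toPlane w) ↔ u ∈ tangentCone C (toPlane w) := by
  have hσ : ((σ : ℤ) : ℝ) * ((σ : ℤ) : ℝ) = 1 := by
    rcases Int.units_eq_one_or σ with rfl | rfl <;> simp
  have hn : 0 < (w 0 : ℝ) ^ 2 + (w 1 : ℝ) ^ 2 := by
    by_contra h
    have h0 : (w 0 : ℝ) = 0 := by nlinarith [sq_nonneg (w 0 : ℝ), sq_nonneg (w 1 : ℝ)]
    have h1 : (w 1 : ℝ) = 0 := by nlinarith [sq_nonneg (w 0 : ℝ), sq_nonneg (w 1 : ℝ)]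
    simp [cross, toPlane, h0, h1] at hu
  set N := (w 0 : ℝ) ^ 2 + (w 1 : ℝ) ^ 2
  have e1 : u = ((((σ : ℤ) : ℝ) * cross (toPlane w) u) / N) • transverse w σ +
      ((w 0 * u 0 + w 1 * u 1) / N) • toPlane w := by
    have hN : N ≠ 0 := hn.ne'
    ext i
    fin_cases i
    · simp only [transverse, toPlane, cross, Pi.add_apply, Pi.smul_apply, smul_eq_mul,
        Fin.zero_eta, Matrix.cons_val_zero]
      field_simp
      linear_combination (u 0) * (rfl : N = (w 0 : ℝ) ^ 2 + (w 1 : ℝ) ^ 2) +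
        ((w 0 : ℝ) * u 1 - w 1 * u 0) * w 1 * hσ
    · simp only [transverse, toPlane, cross, Pi.add_apply, Pi.smul_apply, smul_eq_mul,
        Fin.mk_one, Matrix.cons_val_one, Matrix.cons_val_fin_one]
      field_simp
      linear_combination (u 1) * (rfl : N = (w 0 : ℝ) ^ 2 + (w 1 : ℝ) ^ 2) -
        ((w 0 : ℝ) * u 1 - w 1 * u 0) * w 0 * hσ
  set α := (((σ : ℤ) : ℝ) * cross (toPlane w) u) / N
  set β := (w 0 * u 0 + w 1 * u 1) / N
  have hα : 0 < α := div_pos hu hn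
  constructor
  · intro h
    rw [e1]
    exact transverse_mem_tangentCone hs h β hα
  · intro h
    have h2 := transverse_mem_tangentCone hs h (-(β / α)) (inv_pos.2 hα)
    convert h2 using 1
    rw [e1, smul_add, smul_smul, smul_smul, inv_mul_cancel₀ hα.ne', one_smul, add_assoc, ← add_smul]
    rw [show α⁻¹ * β + -(β / α) = 0 by ring, zero_smul, add_zero]

/-! ### Invariance of the flag sum under `G` -/

/-- The action of `G` on flags. -/
def flagEquiv (d : ℕ) (U : GL (Fin 2) ℤ) (v : Fin 2 → ℤ) : Flag ≃ Flag where
  toFun a := (U.val.mulVec a.1 + (d : ℤ) • v, U.val.mulVec a.2.1,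
    Matrix.GeneralLinearGroup.det U * a.2.2)
  invFun a := ((U⁻¹).val.mulVec (a.1 - (d : ℤ) • v), (U⁻¹).val.mulVec a.2.1,
    (Matrix.GeneralLinearGroup.det U)⁻¹ * a.2.2)
  left_inv a := by simp only [add_sub_cancel_right, inv_mulVec_mulVec, inv_mul_cancel_left]
  right_inv a := by simp only [mulVec_inv_mulVec, sub_add_cancel, mul_inv_cancel_left]

theorem isCoprime_mulVec {U : GL (Fin 2) ℤ} {w : Fin 2 → ℤ} (h : IsCoprime (w 0) (w 1)) :
    IsCoprime (U.val.mulVec w 0) (U.val.mulVec w 1) := by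
  obtain ⟨a, b, hab⟩ := h
  have e := inv_mulVec_mulVec U w
  have e0 := congrFun e 0
  have e1 := congrFun e 1
  set u := U.val.mulVec w
  simp only [Matrix.mulVec, dotProduct, Fin.sum_univ_two] at e0 e1
  refine ⟨a * (U⁻¹).val 0 0 + b * (U⁻¹).val 1 0, a * (U⁻¹).val 0 1 + b * (U⁻¹).val 1 1, ?_⟩
  rw [← e0, ← e1] at hab
  linear_combination hab

theorem isCoprime_mulVec_iff {U : GL (Fin 2) ℤ} {w : Fin 2 → ℤ} :
    IsCoprime (U.val.mulVec w 0) (U.val.mulVec w 1) ↔ IsCoprime (w 0) (w 1) := by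
  refine ⟨fun h => ?_, isCoprime_mulVec⟩
  have := isCoprime_mulVec (U := U⁻¹) h
  rwa [inv_mulVec_mulVec] at this

theorem edgeWeight_eq_cross (d : ℕ) (p q : Fin 2 → ℤ) :
    edgeWeight d p q = ((cross p q : ℤ) : ZMod d) := by
  simp [edgeWeight, cross, Matrix.det_fin_two, mul_comm]

theorem edgeWeight_translate (d : ℕ) (U : GL (Fin 2) ℤ) (v p q : Fin 2 → ℤ) :
    edgeWeight d (U.val.mulVec p + (d : ℤ) • v) (U.val.mulVec q + (d : ℤ) • v) =
      (U.val.det : ZMod d) * edgeWeight d p q := by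
  rw [edgeWeight_eq_cross, edgeWeight_eq_cross, ← Int.cast_mul, ← cross_mulVec]
  simp [cross]

theorem det_mul_self (U : GL (Fin 2) ℤ) : U.val.det * U.val.det = 1 := by
  rw [det_val]
  rcases Int.units_eq_one_or (Matrix.GeneralLinearGroup.det U) with h | h <;> simp [h]

theorem indicator_one_congr {A B : Set Plane} {x y : Plane} (h : x ∈ A ↔ y ∈ B) :
    A.indicator (1 : Plane → ℤ) x = B.indicator 1 y := by
  by_cases hx : x ∈ A
  · rw [Set.indicator_of_mem hx, Set.indicator_of_mem (h.1 hx)]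
    rfl
  · rw [Set.indicator_of_notMem hx, Set.indicator_of_notMem fun hy => hx (h.2 hy)]

theorem flagJump_image {d : ℕ} (hd : 0 < d) (U : GL (Fin 2) ℤ) (v : Fin 2 → ℤ) {S : Set Plane}
    (a : Flag) (ha : IsCoprime (a.2.1 0) (a.2.1 1)) :
    flagJump d (affineUnimodular U v '' S) (flagEquiv d U v a) = flagJump d S a := by
  obtain ⟨z, w, σ⟩ := a
  simp only at ha
  set L := linearPart U
  set C := tangentCone S (latticePoint d z)
  have hC : tangentCone (affineUnimodular U v '' S)
      (latticePoint d (U.val.mulVec z + (d : ℤ) • v)) = L '' C := by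
    rw [← affineUnimodular_latticePoint hd, affineUnimodular_eq]
    exact tangentCone_image L (toPlane v) S _
  have hw : toPlane (U.val.mulVec w) = L (toPlane w) := by
    rw [toPlane_mulVec, linearPart_apply]
  have hC2 : tangentCone (L '' C) (L (toPlane w)) = L '' tangentCone C (toPlane w) := by
    simpa using tangentCone_image L 0 C (toPlane w)
  have hs : ∀ (c : ℝ) (w : Plane), 0 < c → w ∈ L '' C → c • w ∈ L '' C := by
    rw [← hC]
    exact fun c w hc hw => smul_mem_tangentCone hc hw
  have hσ : ((σ : ℤ) : ℝ) * ((σ : ℤ) : ℝ) = 1 := by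
    rcases Int.units_eq_one_or σ with rfl | rfl <;> simp
  have hpos : 0 < (((Matrix.GeneralLinearGroup.det U * σ : ℤˣ) : ℤ) : ℝ) *
      cross (toPlane (U.val.mulVec w)) (L (transverse w σ)) := by
    have hdet : ((U.val.map (Int.cast : ℤ → ℝ)).det) = (U.val.det : ℝ) := by
      simp [Matrix.det_fin_two]
    have hdd : (U.val.det : ℝ) * U.val.det = 1 := by exact_mod_cast det_mul_self U
    have : 0 < (w 0 : ℝ) ^ 2 + (w 1 : ℝ) ^ 2 := by
      have h0 : w 0 ≠ 0 ∨ w 1 ≠ 0 := by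
        by_contra h
        push Not at h
        rw [h.1, h.2] at ha
        exact not_isCoprime_zero_zero ha
      rcases h0 with h | h
      · have : (w 0 : ℝ) ≠ 0 := by exact_mod_cast h
        positivity
      · have : (w 1 : ℝ) ≠ 0 := by exact_mod_cast h
        positivity
    rw [toPlane_mulVec, linearPart_apply, cross_mulVec, hdet, Units.val_mul, ← det_val]
    convert this using 1
    simp only [cross, transverse, toPlane, Pi.smul_apply, smul_eq_mul, Matrix.cons_val_zero,
      Matrix.cons_val_one, Matrix.cons_val_fin_one, Int.cast_mul]
    linear_combination ((w 0 : ℝ) ^ 2 + (w 1 : ℝ) ^ 2) * ((σ : ℤ) : ℝ) ^ 2 * hdd +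
      ((w 0 : ℝ) ^ 2 + (w 1 : ℝ) ^ 2) * hσ
  have hiff := transverse_mem_iff hs hpos
  rw [hw, hC2, L.injective.mem_set_image] at hiff
  have e1 : (L '' C).indicator (1 : Plane → ℤ) (L (toPlane w)) = C.indicator 1 (toPlane w) :=
    indicator_one_congr L.injective.mem_set_image
  simp only [flagJump, flagEquiv, Equiv.coe_fn_mk, hC, hw, hC2, e1]
  congr 1
  exact indicator_one_congr hiff

/-- Reindex by the action on flags. The weight is preserved because (det U)² = 1 and dv vanishes
modulo d. -/
theorem flagSum_image {d : ℕ} (hd : 0 < d) (φ : ZMod d → ℤ) {g : Plane → Plane} (hg : IsGMap g)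
    (S : Set Plane) : flagSum d φ (g '' S) = flagSum d φ S := by
  obtain ⟨U, v, rfl⟩ := hg
  unfold flagSum
  rw [← finsum_comp_equiv (flagEquiv d U v)]
  refine finsum_congr fun a => ?_
  unfold flagTerm
  by_cases ha : IsCoprime (a.2.1 0) (a.2.1 1)
  · have ha' : IsCoprime ((flagEquiv d U v a).2.1 0) ((flagEquiv d U v a).2.1 1) :=
      isCoprime_mulVec ha
    rw [if_pos ha, if_pos ha', flagJump_image hd U v a ha]
    congr 2
    have h1 := det_mul_self U
    have h2 := cross_mulVec U.val a.1 a.2.1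
    simp only [flagEquiv, Equiv.coe_fn_mk, Units.val_mul, ← det_val]
    generalize U.val.det = D at h1 h2 ⊢
    have h3 : ((cross (U.val.mulVec a.1 + (d : ℤ) • v) (U.val.mulVec a.2.1) : ℤ) : ZMod d) =
        ((D * cross a.1 a.2.1 : ℤ) : ZMod d) := by
      rw [← h2]
      simp [cross]
    rw [Int.cast_mul, h3, ← Int.cast_mul]
    congr 1
    linear_combination ((a.2.2 : ℤ) * cross a.1 a.2.1) * h1
  · have ha' : ¬ IsCoprime ((flagEquiv d U v a).2.1 0) ((flagEquiv d U v a).2.1 1) :=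
      fun h => ha (isCoprime_mulVec_iff.1 h)
    rw [if_neg ha, if_neg ha']

/-! ### Finiteness and additivity -/

/-- Two directions with jumps of the same sign on the same side must be parallel, since neither can
lie strictly on side σ of the other. Primitivity leaves at most w and -w for each sign. -/
theorem finite_flagJump_support {d : ℕ} {S : Set Plane} (hS : Convex ℝ S) (z : Fin 2 → ℤ)
    (σ : ℤˣ) :
    {w : Fin 2 → ℤ | IsCoprime (w 0) (w 1) ∧ flagJump d S (z, w, σ) ≠ 0}.Finite := by
  set C := tangentCone S (latticePoint d z) with hCdef
  have hC : Convex ℝ C := convex_tangentCone hS _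
  have hs : ∀ (c : ℝ) (w : Plane), 0 < c → w ∈ C → c • w ∈ C :=
    fun c w hc hw => smul_mem_tangentCone hc hw
  have hzero : ∀ {w w' : Fin 2 → ℤ}, ¬ 0 < ((σ : ℤ) : ℝ) * cross (toPlane w) (toPlane w') →
      ¬ 0 < ((σ : ℤ) : ℝ) * cross (toPlane w') (toPlane w) → cross w w' = 0 := by
    intro w w' h1 h2
    rw [cross_toPlane] at h1 h2
    norm_cast at h1 h2
    unfold cross at *
    rcases Int.units_eq_one_or σ with rfl | rfl <;> simp at h1 h2 <;> linarith
  have h1 : {w : Fin 2 → ℤ | IsCoprime (w 0) (w 1) ∧ toPlane w ∈ C ∧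
      transverse w σ ∉ tangentCone C (toPlane w)}.Finite := by
    refine finite_of_cross_eq_zero (fun w hw => hw.1) ?_
    -- If w' ∈ C is on side σ of w ∈ C, tilting w towards w' stays in the convex cone, so w has no
    -- jump.
    have key : ∀ {w w' : Fin 2 → ℤ}, toPlane w ∈ C → toPlane w' ∈ C →
        transverse w σ ∉ tangentCone C (toPlane w) →
        ¬ 0 < ((σ : ℤ) : ℝ) * cross (toPlane w) (toPlane w') := fun hw hw' hn hpos =>
      hn ((transverse_mem_iff hs hpos).2 (mem_tangentCone_of_mem hC hs hw hw'))
    exact fun w hw w' hw' => hzero (key hw.2.1 hw'.2.1 hw.2.2) (key hw'.2.1 hw.2.1 hw'.2.2)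
  have h2 : {w : Fin 2 → ℤ | IsCoprime (w 0) (w 1) ∧ toPlane w ∉ C ∧
      transverse w σ ∈ tangentCone C (toPlane w)}.Finite := by
    refine finite_of_cross_eq_zero (fun w hw => hw.1) ?_
    -- If w' is on side σ of w, then -w is on side σ of w'. So w + δw' and w' - δw lie in C for
    -- small δ, and (w' - δw) + δ(w + δw') = (1 + δ²)w' puts w' in C.
    have key : ∀ {w w' : Fin 2 → ℤ}, transverse w σ ∈ tangentCone C (toPlane w) →
        transverse w' σ ∈ tangentCone C (toPlane w') → toPlane w' ∉ C →
        ¬ 0 < ((σ : ℤ) : ℝ) * cross (toPlane w) (toPlane w') := by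
      intro w w' hw hw' hn hpos
      have a1 := (transverse_mem_iff hs hpos).1 hw
      have a2 := (transverse_mem_iff hs (w := w') (u := -toPlane w) (σ := σ) (by
        convert hpos using 1
        simp only [cross, Pi.neg_apply]
        ring)).1 hw'
      rw [mem_tangentCone] at a1 a2
      obtain ⟨δ, ⟨b1, b2⟩, b3⟩ := ((a1.and a2).and self_mem_nhdsWithin).exists
      have b3' : (0 : ℝ) < δ := b3
      have b4 := add_mem_of_convex_cone hC hs b2 (hs δ _ b3' b1)
      apply hn
      have hp : 0 < 1 + δ ^ 2 := by positivity
      have := hs _ _ (inv_pos.2 hp) b4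
      convert this using 1
      rw [show toPlane w' + δ • -toPlane w + δ • (toPlane w + δ • toPlane w') =
        (1 + δ ^ 2) • toPlane w' by module, smul_smul, inv_mul_cancel₀ hp.ne', one_smul]
    exact fun w hw w' hw' => hzero (key hw.2.2 hw'.2.2 hw'.2.1) (key hw'.2.2 hw.2.2 hw.2.1)
  refine (h1.union h2).subset ?_
  rintro w ⟨hw, hj⟩
  simp only [flagJump, ← hCdef] at hj
  by_cases c1 : toPlane w ∈ C <;> by_cases c2 : transverse w σ ∈ tangentCone C (toPlane w) <;>
    simp [c1, c2] at hj ⊢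
  · exact hw
  · exact hw

theorem finite_latticePoint_mem {d : ℕ} (hd : 0 < d) {S : Set Plane}
    (hS : Bornology.IsBounded S) : {z : Fin 2 → ℤ | latticePoint d z ∈ S}.Finite := by
  obtain ⟨R, hR⟩ := hS.exists_norm_le
  have hd' : (0 : ℝ) < d := by exact_mod_cast hd
  refine (Set.finite_Icc (fun _ : Fin 2 => -⌈d * R⌉) (fun _ => ⌈d * R⌉)).subset ?_
  intro z hz
  have h : ∀ i, |(z i : ℝ)| ≤ d * R := by
    intro i
    have h1 := (norm_le_pi_norm (latticePoint d z) i).trans (hR _ hz)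
    rw [latticePoint, Real.norm_eq_abs, abs_div, abs_of_pos hd', div_le_iff₀ hd'] at h1
    linarith
  constructor <;> intro i
  · have h1 := (abs_le.1 (h i)).1
    have h2 := Int.le_ceil (d * R)
    have : -(⌈d * R⌉ : ℝ) ≤ z i := by linarith
    exact_mod_cast this
  · have h1 := (abs_le.1 (h i)).2
    have h2 := Int.le_ceil (d * R)
    have : (z i : ℝ) ≤ ⌈d * R⌉ := by linarith
    exact_mod_cast this

theorem finite_flagTerm_support {d : ℕ} (hd : 0 < d) (φ : ZMod d → ℤ) {S : Set Plane}
    (hS : Convex ℝ S) (hb : Bornology.IsBounded S) : (Function.support (flagTerm d φ S)).Finite := by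
  have hfin : (⋃ z ∈ {z : Fin 2 → ℤ | latticePoint d z ∈ closure S}, ⋃ σ : ℤˣ,
      (fun w => ((z, w, σ) : Flag)) ''
        {w : Fin 2 → ℤ | IsCoprime (w 0) (w 1) ∧ flagJump d S (z, w, σ) ≠ 0}).Finite :=
    (finite_latticePoint_mem hd hb.closure).biUnion fun z _ =>
      Set.finite_iUnion fun σ => (finite_flagJump_support hS z σ).image _
  refine hfin.subset ?_
  rintro ⟨z, w, σ⟩ ha
  rw [Function.mem_support, flagTerm] at ha
  split_ifs at ha with hw
  · have hj := right_ne_zero_of_mul ha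
    simp only [Set.mem_iUnion, Set.mem_image]
    refine ⟨z, ?_, σ, w, ⟨hw, hj⟩, rfl⟩
    by_contra hz
    have hC : tangentCone S (latticePoint d z) = ∅ :=
      Set.eq_empty_of_forall_notMem fun u hu => hz (mem_closure_of_mem_tangentCone hu)
    apply hj
    have hCC : tangentCone (∅ : Set Plane) (toPlane w) = ∅ :=
      Set.eq_empty_of_forall_notMem fun u hu => by
        simpa using mem_closure_of_mem_tangentCone hu
    simp [flagJump, hC, hCC]
  · exact absurd rfl ha

theorem flagSum_iUnion {ι : Type*} [Fintype ι] {S : ι → Set Plane} (hS : ∀ i, Convex ℝ (S i))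
    (hb : ∀ i, Bornology.IsBounded (S i)) (hd : Pairwise fun i j => Disjoint (S i) (S j)) {d : ℕ}
    (hpos : 0 < d) (φ : ZMod d → ℤ) : flagSum d φ (⋃ i, S i) = ∑ i, flagSum d φ (S i) := by
  unfold flagSum
  rw [finsum_congr fun a => flagTerm_iUnion hS hd d φ a]
  exact finsum_sum_comm _ _ fun i _ => finite_flagTerm_support hpos φ (hS i) (hb i)

/-! ### Invariance under equidecomposition -/

theorem convex_openSimplex {n : ℕ} (s : Affine.Simplex ℝ Plane n) : Convex ℝ (openSimplex s) := by
  rintro _ ⟨w, hw, hw1, rfl⟩ _ ⟨u, hu, hu1, rfl⟩ a b ha hb hab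
  refine ⟨fun i => a * w i + b * u i, fun i => ?_, ?_, ?_⟩
  · rcases ha.eq_or_lt with rfl | ha
    · rw [zero_add] at hab
      simpa [hab] using hu i
    · exact add_pos_of_pos_of_nonneg (mul_pos ha (hw i)) (mul_nonneg hb (hu i).le)
  · rw [Finset.sum_add_distrib, ← Finset.mul_sum, ← Finset.mul_sum, hw1, hu1, mul_one, mul_one, hab]
  · simp only [add_smul, Finset.sum_add_distrib, mul_smul, Finset.smul_sum]

theorem openSimplex_subset_convexHull {n : ℕ} (s : Affine.Simplex ℝ Plane n) :
    openSimplex s ⊆ convexHull ℝ (Set.range s.points) := by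
  rintro _ ⟨w, hw, hw1, rfl⟩
  exact (convex_convexHull ℝ _).sum_mem (fun i _ => (hw i).le) hw1
    fun i _ => subset_convexHull ℝ _ ⟨i, rfl⟩

theorem isBounded_openSimplex {n : ℕ} (s : Affine.Simplex ℝ Plane n) :
    Bornology.IsBounded (openSimplex s) :=
  (isBounded_convexHull.2 (Set.finite_range s.points).isBounded).subset (openSimplex_subset_convexHull s)

theorem IsGMap.convex_image {g : Plane → Plane} (hg : IsGMap g) {S : Set Plane}
    (hS : Convex ℝ S) : Convex ℝ (g '' S) := by
  obtain ⟨U, v, rfl⟩ := hg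
  rw [affineUnimodular_eq, ← Set.image_image (· + toPlane v) (linearPart U)]
  have := (hS.linear_image (linearPart U).toLinearMap).translate (toPlane v)
  simp only [add_comm (toPlane v)] at this
  exact this

theorem IsGMap.continuous {g : Plane → Plane} (hg : IsGMap g) : Continuous g := by
  obtain ⟨U, v, rfl⟩ := hg
  rw [affineUnimodular_eq]
  exact (LinearMap.continuous_of_finiteDimensional (linearPart U).toLinearMap).add
    continuous_const

theorem IsGMap.isBounded_image {g : Plane → Plane} (hg : IsGMap g) {S : Set Plane}
    (hS : Bornology.IsBounded S) : Bornology.IsBounded (g '' S) :=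
  ((hS.isCompact_closure.image hg.continuous).isBounded).subset
    (Set.image_mono subset_closure)

/-- The flag sum is an invariant of equidecomposability. -/
theorem Equidecomposable.flagSum_eq {P Q : Set Plane} (h : Equidecomposable P Q) {d : ℕ}
    (hd : 0 < d) (φ : ZMod d → ℤ) : flagSum d φ P = flagSum d φ Q := by
  obtain ⟨r, T, g, hT, hg, hdT, rfl, hdg, rfl⟩ := h
  have hc : ∀ i, Convex ℝ (T i) := fun i => by
    obtain ⟨n, s, -, h⟩ := hT i
    exact h ▸ convex_openSimplex s
  have hb : ∀ i, Bornology.IsBounded (T i) := fun i => by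
    obtain ⟨n, s, -, h⟩ := hT i
    exact h ▸ isBounded_openSimplex s
  rw [flagSum_iUnion hc hb hdT hd, flagSum_iUnion (fun i => (hg i).convex_image (hc i))
    (fun i => (hg i).isBounded_image (hb i)) hdg hd]
  exact Finset.sum_congr rfl fun i _ => (flagSum_image hd φ (hg i) _).symm

/-! ### The model triangle -/

/-- The triangle with vertices `(s, 1) / d`, `(s, 0) / d` and `(s - 1, 1) / d`. -/
def cornerTriangle (d : ℕ) (s : ℤ) : Set Plane :=
  {x | (d : ℝ) * x 0 - s ≤ 0 ∧ (d : ℝ) * x 1 - 1 ≤ 0 ∧ s - (d : ℝ) * x 0 - d * x 1 ≤ 0}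

theorem convex_cornerTriangle (d : ℕ) (s : ℤ) : Convex ℝ (cornerTriangle d s) := by
  rintro x ⟨hx0, hx1, hx2⟩ y ⟨hy0, hy1, hy2⟩ a b ha hb hab
  refine ⟨?_, ?_, ?_⟩ <;> simp only [Pi.add_apply, Pi.smul_apply, smul_eq_mul]
  · linear_combination a * hx0 + b * hy0 + (s : ℝ) * hab
  · linear_combination a * hx1 + b * hy1 + hab
  · linear_combination a * hx2 + b * hy2 - (s : ℝ) * hab

theorem latticePoint_mem_cornerTriangle {d : ℕ} (hd : 0 < d) {s : ℤ} {z : Fin 2 → ℤ} :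
    latticePoint d z ∈ cornerTriangle d s ↔ z 0 ≤ s ∧ z 1 ≤ 1 ∧ s ≤ z 0 + z 1 := by
  have hd' : (d : ℝ) ≠ 0 := by positivity
  simp only [cornerTriangle, latticePoint, Set.mem_ofPred_eq, mul_div_cancel₀ _ hd']
  rw [sub_nonpos, sub_nonpos, sub_sub, sub_nonpos]
  norm_cast

theorem latticePoint_mem_cornerTriangle_iff {d : ℕ} (hd : 0 < d) {s : ℤ} {z : Fin 2 → ℤ} :
    latticePoint d z ∈ cornerTriangle d s ↔ z = ![s, 1] ∨ z = ![s, 0] ∨ z = ![s - 1, 1] := by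
  rw [latticePoint_mem_cornerTriangle hd]
  simp only [funext_iff, Fin.forall_fin_two, Matrix.cons_val_zero, Matrix.cons_val_one,
    Matrix.cons_val_fin_one]
  omega

theorem convexHull_eq_cornerTriangle {d : ℕ} (hd : 0 < d) (s : ℤ) :
    convexHull ℝ {latticePoint d ![s, 1], latticePoint d ![s, 0], latticePoint d ![s - 1, 1]} =
      cornerTriangle d s := by
  have hd' : (d : ℝ) ≠ 0 := by positivity
  apply Set.Subset.antisymm
  · refine convexHull_min ?_ (convex_cornerTriangle d s)
    rintro _ (rfl | rfl | rfl) <;> simp [latticePoint_mem_cornerTriangle_iff hd]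
  · rintro x ⟨h0, h1, h2⟩
    have := (convex_convexHull ℝ ({latticePoint d ![s, 1], latticePoint d ![s, 0],
      latticePoint d ![s - 1, 1]} : Set Plane)).sum_mem (t := Finset.univ)
      -- The barycentric coordinates of x: each is minus one of the defining affine forms.
      (w := ![d * x 0 + d * x 1 - s, 1 - d * x 1, s - d * x 0])
      (z := ![latticePoint d ![s, 1], latticePoint d ![s, 0], latticePoint d ![s - 1, 1]])
      (by intro i _; fin_cases i <;> simp <;> linarith)
      (by simp [Fin.sum_univ_three]; ring)
      (by intro i _; apply subset_convexHull; fin_cases i <;> simp)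
    convert this using 1
    ext i
    fin_cases i <;> simp [Fin.sum_univ_three, latticePoint] <;> field_simp <;> ring

theorem leftTriangle_eq {d : ℕ} (hd : 0 < d) (t : ℤ) :
    leftTriangle d t = cornerTriangle d (1 + t) := by
  rw [← convexHull_eq_cornerTriangle hd, leftTriangle]
  congr 1
  have h : ∀ a b : ℤ, latticePoint d ![a, b] = ![(a : ℝ) / d, (b : ℝ) / d] := fun a b => by
    ext i; fin_cases i <;> rfl
  simp [h]

theorem rightTriangle_eq {d : ℕ} (hd : 0 < d) (t : ℤ) :
    rightTriangle d t = cornerTriangle d (2 + t) := by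
  rw [show 2 + t = 1 + (1 + t) by ring, ← leftTriangle_eq hd, rightTriangle, leftTriangle]
  push_cast
  rw [show (1 : ℝ) + (1 + t) = 2 + t by ring]

theorem isMinimalTriangle_cornerTriangle {d : ℕ} (hd : 0 < d) (s : ℤ) :
    IsMinimalTriangle d (cornerTriangle d s) := by
  have hd' : (d : ℝ) ≠ 0 := by positivity
  have hr : Set.range ![latticePoint d ![s, 1], latticePoint d ![s, 0], latticePoint d ![s - 1, 1]]
      = {latticePoint d ![s, 1], latticePoint d ![s, 0], latticePoint d ![s - 1, 1]} := by
    ext x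
    simp
    tauto
  refine ⟨_, ?_, by rw [hr, convexHull_eq_cornerTriangle hd], ?_⟩
  · rw [affineIndependent_iff_of_fintype]
    intro w hw h
    rw [Finset.weightedVSub_eq_linear_combination _ hw] at h
    have h0 := congrFun h 0
    have h1 := congrFun h 1
    simp [Fin.sum_univ_three, latticePoint] at hw h0 h1
    field_simp at h0 h1
    have e1 : w 1 = 0 := by linarith
    have e2 : w 2 = 0 := by linear_combination (s : ℝ) * hw - h0
    intro i
    fin_cases i <;> simp <;> linarith
  · rw [hr]
    ext x
    constructor
    · rintro ⟨hx, z, rfl⟩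
      rcases (latticePoint_mem_cornerTriangle_iff hd).1 hx with rfl | rfl | rfl <;> simp
    · rintro (rfl | rfl | rfl) <;>
        exact ⟨(latticePoint_mem_cornerTriangle_iff hd).2 (by simp), _, rfl⟩

/-! ### Ehrhart functions -/

theorem ehr_image {g : Plane → Plane} (hg : IsGMap g) (S : Set Plane) (k : ℕ) :
    ehr (g '' S) k = ehr S k := by
  obtain ⟨U, v, rfl⟩ := hg
  have hinj : Function.Injective fun z => U.val.mulVec z + (k : ℤ) • v := fun a b h => by
    have := congrArg (U⁻¹).val.mulVec (add_right_cancel h)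
    rwa [inv_mulVec_mulVec, inv_mulVec_mulVec] at this
  unfold ehr
  rw [← Set.ncard_image_of_injective {z : Fin 2 → ℤ | _ ∈ _ '' S} hinj]
  congr 1
  have key : ∀ z, (fun i => ((U.val.mulVec z + (k : ℤ) • v) i : ℝ)) ∈
      (fun x : Plane => (k : ℝ) • x) '' (affineUnimodular U v '' S) ↔
      (fun i => (z i : ℝ)) ∈ (fun x : Plane => (k : ℝ) • x) '' S := by
    intro z
    have e : (fun i => ((U.val.mulVec z + (k : ℤ) • v) i : ℝ)) =
        linearPart U (toPlane z) + (k : ℝ) • toPlane v := by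
      rw [linearPart_apply, ← toPlane_mulVec]
      ext i
      simp [toPlane]
    rw [e, affineUnimodular_eq, Set.image_image]
    simp only [Set.mem_image, smul_add, ← map_smul, add_left_inj, EmbeddingLike.apply_eq_iff_eq]
    rfl
  ext z
  simp only [Set.mem_ofPred_eq, Set.mem_image]
  constructor
  · intro h
    have hz : U.val.mulVec ((U⁻¹).val.mulVec (z - (k : ℤ) • v)) + (k : ℤ) • v = z := by
      rw [mulVec_inv_mulVec, sub_add_cancel]
    refine ⟨_, (key _).1 ?_, hz⟩
    rw [hz]
    exact h
  · rintro ⟨y, hy, rfl⟩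
    exact (key y).2 hy

theorem mem_dilate_cornerTriangle {d : ℕ} (hd : 0 < d) {s : ℤ} {k : ℕ} {z : Fin 2 → ℤ} :
    (fun i => (z i : ℝ)) ∈ (fun x : Plane => (k : ℝ) • x) '' cornerTriangle d s ↔
      d * z 0 ≤ k * s ∧ d * z 1 ≤ k ∧ k * s ≤ d * z 0 + d * z 1 := by
  have hd' : (0 : ℤ) < d := by exact_mod_cast hd
  -- For k = 0 one cannot divide by k: the dilate is the origin, the only integer solution of the
  -- inequalities.
  rcases Nat.eq_zero_or_pos k with rfl | hk
  · have hne : (cornerTriangle d s).Nonempty :=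
      ⟨_, (latticePoint_mem_cornerTriangle_iff (z := ![s, 1]) hd).2 (by simp)⟩
    simp only [Nat.cast_zero, zero_smul, hne.image_const, Set.mem_singleton_iff, funext_iff,
      Fin.forall_fin_two, Pi.zero_apply, Int.cast_eq_zero, zero_mul]
    constructor
    · rintro ⟨h0, h1⟩
      simp [h0, h1]
    · rintro ⟨h0, h1, h2⟩
      have a0 : z 0 ≤ 0 := by nlinarith
      have a1 : z 1 ≤ 0 := by nlinarith
      have a2 : 0 ≤ z 0 + z 1 := by nlinarith
      omega
  · have hk' : (0 : ℝ) < k := by exact_mod_cast hk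
    have key : (fun i => (z i : ℝ)) ∈ (fun x : Plane => (k : ℝ) • x) '' cornerTriangle d s ↔
        (d * z 0 : ℝ) ≤ k * s ∧ (d * z 1 : ℝ) ≤ k ∧ (k * s : ℝ) ≤ d * z 0 + d * z 1 := by
      constructor
      · rintro ⟨x, ⟨h0, h1, h2⟩, hx⟩
        have e0 : (k : ℝ) * x 0 = z 0 := congrFun hx 0
        have e1 : (k : ℝ) * x 1 = z 1 := congrFun hx 1
        rw [← e0, ← e1]
        refine ⟨?_, ?_, ?_⟩
        · linear_combination (k : ℝ) * h0
        · linear_combination (k : ℝ) * h1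
        · linear_combination (k : ℝ) * h2
      · rintro ⟨h0, h1, h2⟩
        refine ⟨fun i => (z i : ℝ) / k, ⟨?_, ?_, ?_⟩, ?_⟩
        · have : (d : ℝ) * (z 0 / k) - s = (d * z 0 - k * s) / k := by field_simp
          rw [this]
          exact div_nonpos_of_nonpos_of_nonneg (by linarith) hk'.le
        · have : (d : ℝ) * (z 1 / k) - 1 = (d * z 1 - k) / k := by field_simp
          rw [this]
          exact div_nonpos_of_nonpos_of_nonneg (by linarith) hk'.le
        · have : (s : ℝ) - d * (z 0 / k) - d * (z 1 / k) = (k * s - (d * z 0 + d * z 1)) / k := by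
            field_simp
            ring
          rw [this]
          exact div_nonpos_of_nonpos_of_nonneg (by linarith) hk'.le
        · ext i
          simp only [Pi.smul_apply, smul_eq_mul]
          field_simp
    rw [key]
    norm_cast

/-- In row y the first coordinate runs from ⌈ks/d⌉ - y to ⌊ks/d⌋. Rounding costs one point unless d
divides ks, which by coprimality means that d divides k. -/
theorem ehr_cornerTriangle {d : ℕ} (hd : 0 < d) {s : ℤ} (hs : IsCoprime s (d : ℤ)) (k : ℕ) :
    ehr (cornerTriangle d s) k =
      ∑ y ∈ Finset.range (k / d + 1), (y + if k % d = 0 then 1 else 0) := by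
  have hd' : (0 : ℤ) < d := by exact_mod_cast hd
  set δ := if k % d = 0 then 1 else 0 with hδ
  set e : ℤ := (k * s) / d with he
  have hdiv : (d : ℤ) * e + (k * s) % d = k * s := Int.mul_ediv_add_emod _ _
  have hmod0 := Int.emod_nonneg (k * s) hd'.ne'
  have hmod1 := Int.emod_lt_of_pos (k * s) hd'
  have hmod : (k * s) % (d : ℤ) = 0 ↔ k % d = 0 := by
    rw [← Int.dvd_iff_emod_eq_zero, ← Nat.dvd_iff_mod_eq_zero, ← Int.natCast_dvd_natCast]
    exact ⟨fun h => hs.symm.dvd_of_dvd_mul_right h, fun h => h.mul_right s⟩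
  have hinj : Function.Injective fun a : (_ : ℕ) × ℕ => (![e - a.2, a.1] : Fin 2 → ℤ) := by
    rintro ⟨y, i⟩ ⟨y', i'⟩ h
    have h0 := congrFun h 0
    have h1 := congrFun h 1
    simp at h0 h1
    rw [h0, h1]
  have hset : {z : Fin 2 → ℤ | (fun i => (z i : ℝ)) ∈
      (fun x : Plane => (k : ℝ) • x) '' cornerTriangle d s} =
      (fun a : (_ : ℕ) × ℕ => (![e - a.2, a.1] : Fin 2 → ℤ)) ''
        ((Finset.range (k / d + 1)).sigma fun y => Finset.range (y + δ)) := by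
    ext z
    rw [Set.mem_ofPred_eq, mem_dilate_cornerTriangle hd]
    have c0 : (d : ℤ) * z 0 ≤ k * s ↔ z 0 ≤ e := by
      rw [he, Int.le_ediv_iff_mul_le hd', mul_comm]
    have c1 : (d : ℤ) * z 1 ≤ k ↔ z 1 ≤ (k / d : ℕ) := by
      rw [Int.natCast_div, Int.le_ediv_iff_mul_le hd', mul_comm]
    -- Here e + 1 - δ is ⌈ks/d⌉.
    have c2 : (k * s : ℤ) ≤ d * z 0 + d * z 1 ↔ e + 1 - δ ≤ z 0 + z 1 := by
      rw [← mul_add]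
      by_cases h : k % d = 0
      · rw [← hdiv, hmod.2 h, add_zero, mul_le_mul_iff_right₀ hd', hδ, if_pos h]
        simp
      · have h' : 0 < (k * s) % (d : ℤ) := lt_of_le_of_ne hmod0 (Ne.symm (mt hmod.1 h))
        rw [hδ, if_neg h, Nat.cast_zero, sub_zero, Int.add_one_le_iff]
        constructor
        · intro h2
          refine lt_of_mul_lt_mul_left ?_ hd'.le
          linarith
        · intro h2
          have : (d : ℤ) * (e + 1) ≤ d * (z 0 + z 1) := mul_le_mul_of_nonneg_left h2 hd'.le
          linarith
    have hδ1 : δ ≤ 1 := by rw [hδ]; split_ifs <;> simp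
    rw [c0, c1, c2]
    simp only [Set.mem_image, Finset.mem_coe, Finset.mem_sigma, Finset.mem_range, Sigma.exists]
    constructor
    · rintro ⟨h0, h1, h2⟩
      refine ⟨(z 1).toNat, (e - z 0).toNat, by omega, ?_⟩
      ext i
      fin_cases i <;> simp <;> omega
    · rintro ⟨y, i, h, rfl⟩
      simp
      omega
  rw [ehr, hset, Set.ncard_image_of_injective _ hinj, Set.ncard_coe_finset, Finset.card_sigma]
  simp

theorem isQuasiPolynomial_ehr_cornerTriangle {d : ℕ} (hd : 0 < d) {s : ℤ}
    (hs : IsCoprime s (d : ℤ)) :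
    IsQuasiPolynomial d fun k => (ehr (cornerTriangle d s) k : ℝ) := by
  have hd' : (d : ℝ) ≠ 0 := by positivity
  -- Substitute m = (k - i)/d into m(m + 1)/2 + δ(m + 1), where δ is 1 for i = 0 and 0 otherwise.
  refine ⟨hd, fun i => Polynomial.C (1 / (2 * (d : ℝ) ^ 2)) * Polynomial.X ^ 2 +
    Polynomial.C (-(i.val : ℝ) / d ^ 2 + 1 / (2 * d) + (if i.val = 0 then 1 else 0) / d) *
      Polynomial.X + Polynomial.C ((i.val : ℝ) ^ 2 / (2 * d ^ 2) - i.val / (2 * d) -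
      (if i.val = 0 then 1 else 0) * i.val / d + if i.val = 0 then 1 else 0), fun i j => ?_,
      fun k => ?_⟩
  · have : 1 / (2 * (d : ℝ) ^ 2) ≠ 0 := by positivity
    rw [Polynomial.degree_quadratic this, Polynomial.degree_quadratic this]
  · have hsum : ∀ (m : ℕ) (δ : ℝ), ∑ y ∈ Finset.range (m + 1), ((y : ℝ) + δ) =
        m * (m + 1) / 2 + δ * (m + 1) := by
      intro m δ
      induction m with
      | zero => simp
      | succ m ih => rw [Finset.sum_range_succ, ih]; push_cast; ring
    have hk : (k : ℝ) = d * (k / d : ℕ) + (k % d : ℕ) := by exact_mod_cast (Nat.div_add_mod k d).symm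
    simp only [ehr_cornerTriangle hd hs, ZMod.val_natCast]
    push_cast
    rw [hsum]
    simp only [Polynomial.eval_add, Polynomial.eval_mul, Polynomial.eval_C, Polynomial.eval_pow,
      Polynomial.eval_X]
    generalize (if k % d = 0 then (1 : ℝ) else 0) = δ
    rw [hk]
    field_simp
    ring

/-! ### Weights -/

theorem IsGMap.exists_leftInverse {g : Plane → Plane} (hg : IsGMap g) :
    ∃ g', IsGMap g' ∧ Function.LeftInverse g' g := by
  obtain ⟨U, v, rfl⟩ := hg
  refine ⟨affineUnimodular U⁻¹ (-(U⁻¹).val.mulVec v), ⟨_, _, rfl⟩, fun x => ?_⟩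
  rw [affineUnimodular_eq, affineUnimodular_eq]
  simp only [toPlane_neg, map_add, linearPart_apply, toPlane_mulVec, Matrix.mulVec_mulVec]
  rw [map_inv_mul_map, Matrix.one_mulVec, add_neg_cancel_right]

theorem IsGMap.image_convexHull {g : Plane → Plane} (hg : IsGMap g) (S : Set Plane) :
    g '' convexHull ℝ S = convexHull ℝ (g '' S) := by
  obtain ⟨U, v, rfl⟩ := hg
  exact ((linearPart U).toLinearMap.toAffineMap +
    AffineMap.const ℝ Plane (toPlane v)).image_convexHull S

theorem triple_rotate {α : Type*} (a b c : α) : ({a, b, c} : Multiset α) = {b, c, a} :=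
  Multiset.coe_eq_coe.2 (List.perm_append_comm (l₁ := [a]) (l₂ := [b, c]))

theorem triple_reverse {α : Type*} (a b c : α) : ({a, b, c} : Multiset α) = {c, b, a} :=
  Multiset.coe_eq_coe.2 (List.reverse_perm [c, b, a])

theorem edgeWeight_swap (d : ℕ) (p q : Fin 2 → ℤ) : edgeWeight d p q = -edgeWeight d q p := by
  rw [edgeWeight_eq_cross, edgeWeight_eq_cross, ← Int.cast_neg]
  congr 1
  unfold cross
  ring

/-- If det U = -1, every determinant changes sign, but the counterclockwise order is reversed too,
and the two signs cancel. -/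
theorem HasWeight.image {d : ℕ} (hd : 0 < d) {g : Plane → Plane} (hg : IsGMap g) {T : Set Plane}
    {W : Multiset (ZMod d)} (h : HasWeight d T W) : HasWeight d (g '' T) W := by
  obtain ⟨p, q, r, rfl, hdet, rfl⟩ := h
  have him := hg.image_convexHull {latticePoint d p, latticePoint d q, latticePoint d r}
  obtain ⟨U, v, rfl⟩ := hg
  rw [Set.image_insert_eq, Set.image_pair, affineUnimodular_latticePoint hd,
    affineUnimodular_latticePoint hd, affineUnimodular_latticePoint hd] at him
  have hdet' : 0 < cross (q - p) (r - p) := by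
    rw [Matrix.det_fin_two_of] at hdet
    simp only [cross, Pi.sub_apply]
    linarith
  have hc := cross_mulVec U.val (q - p) (r - p)
  simp only [Matrix.mulVec_sub, cross, Pi.sub_apply] at hc hdet'
  have hdd : U.val.det = 1 ∨ U.val.det = -1 := by
    rw [det_val]
    exact Int.isUnit_iff.1 (Units.isUnit _)
  rcases hdd with h | h
  · refine ⟨_, _, _, him, ?_, ?_⟩
    · rw [h] at hc
      simp only [Matrix.det_fin_two_of, Pi.add_apply]
      linarith
    · simp only [edgeWeight_translate, h, Int.cast_one, one_mul]
  · rw [Set.pair_comm (latticePoint d (U.val.mulVec q + (d : ℤ) • v))] at him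
    refine ⟨_, _, _, him, ?_, ?_⟩
    · rw [h] at hc
      simp only [Matrix.det_fin_two_of, Pi.add_apply]
      linarith
    · simp only [edgeWeight_translate, h, Int.cast_neg, Int.cast_one, neg_one_mul]
      rw [← edgeWeight_swap, ← edgeWeight_swap, ← edgeWeight_swap]
      exact triple_reverse _ _ _

theorem hasWeight_image_iff {d : ℕ} (hd : 0 < d) {g : Plane → Plane} (hg : IsGMap g)
    {T : Set Plane} {W : Multiset (ZMod d)} : HasWeight d (g '' T) W ↔ HasWeight d T W := by
  refine ⟨fun h => ?_, fun h => h.image hd hg⟩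
  obtain ⟨g', hg', hinv⟩ := hg.exists_leftInverse
  have := h.image hd hg'
  rwa [hinv.image_image] at this

theorem hasWeight_cornerTriangle_iff {d : ℕ} (hd : 0 < d) {s : ℤ} {W : Multiset (ZMod d)} :
    HasWeight d (cornerTriangle d s) W ↔ W = {(s : ZMod d), 1, -(s : ZMod d)} := by
  constructor
  · rintro ⟨p, q, r, hT, hdet, rfl⟩
    have hmem : ∀ z, latticePoint d z ∈
        ({latticePoint d p, latticePoint d q, latticePoint d r} : Set Plane) →
        z = ![s, 1] ∨ z = ![s, 0] ∨ z = ![s - 1, 1] := fun z hz => by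
      rw [← latticePoint_mem_cornerTriangle_iff hd, hT]
      exact subset_convexHull ℝ _ hz
    simp only [edgeWeight_eq_cross]
    -- Of the 27 choices of vertices only the three counterclockwise labellings have positive
    -- determinant.
    rcases hmem p (by simp) with rfl | rfl | rfl <;> rcases hmem q (by simp) with rfl | rfl | rfl <;>
      rcases hmem r (by simp) with rfl | rfl | rfl <;>
      simp [Matrix.det_fin_two] at hdet <;> simp [cross]
    · exact (triple_rotate _ _ _).symm
    · exact triple_rotate _ _ _
  · rintro rfl
    refine ⟨![s, 1], ![s - 1, 1], ![s, 0], ?_, by simp [Matrix.det_fin_two], ?_⟩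
    · rw [← convexHull_eq_cornerTriangle hd, Set.pair_comm]
    · simp [edgeWeight_eq_cross, cross]
      exact triple_rotate _ _ _

/-! ### The flag sum of the model triangle -/

theorem mem_tangentCone_cornerTriangle {d : ℕ} (hd : 0 < d) {s : ℤ} {z : Fin 2 → ℤ} {w : Plane} :
    w ∈ tangentCone (cornerTriangle d s) (latticePoint d z) ↔
      (z 0 - s < 0 ∨ z 0 - s = 0 ∧ w 0 ≤ 0) ∧ (z 1 - 1 < 0 ∨ z 1 - 1 = 0 ∧ w 1 ≤ 0) ∧
        (s - z 0 - z 1 < 0 ∨ s - z 0 - z 1 = 0 ∧ -w 0 - w 1 ≤ 0) := by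
  have hd' : (0 : ℝ) < d := by exact_mod_cast hd
  have key : ∀ (a : ℤ) (b : ℝ), (∀ᶠ ε in 𝓝[>] (0 : ℝ), (a : ℝ) + ε * (d * b) ≤ 0) ↔
      a < 0 ∨ a = 0 ∧ b ≤ 0 := fun a b => by
    rw [eventually_add_mul_nonpos_iff, show (d : ℝ) * b ≤ 0 ↔ b ≤ 0 from
      ⟨fun h => nonpos_of_mul_nonpos_right h hd', mul_nonpos_of_nonneg_of_nonpos hd'.le⟩]
    norm_cast
  rw [← key, ← key, ← key, ← eventually_and, ← eventually_and, mem_tangentCone]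
  refine eventually_congr (Eventually.of_forall fun ε => ?_)
  simp only [cornerTriangle, latticePoint, Set.mem_ofPred_eq, Pi.add_apply, Pi.smul_apply,
    smul_eq_mul, mul_add, mul_div_cancel₀ _ hd'.ne', Int.cast_sub, Int.cast_one]
  refine and_congr ?_ (and_congr ?_ ?_) <;> ring_nf

theorem mem_tangentCone_tangentCone_cornerTriangle {d : ℕ} (hd : 0 < d) {s : ℤ}
    {z : Fin 2 → ℤ} {w u : Plane} :
    u ∈ tangentCone (tangentCone (cornerTriangle d s) (latticePoint d z)) w ↔
      (z 0 - s < 0 ∨ z 0 - s = 0 ∧ (w 0 < 0 ∨ w 0 = 0 ∧ u 0 ≤ 0)) ∧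
      (z 1 - 1 < 0 ∨ z 1 - 1 = 0 ∧ (w 1 < 0 ∨ w 1 = 0 ∧ u 1 ≤ 0)) ∧
      (s - z 0 - z 1 < 0 ∨ s - z 0 - z 1 = 0 ∧
        (-w 0 - w 1 < 0 ∨ -w 0 - w 1 = 0 ∧ -u 0 - u 1 ≤ 0)) := by
  rw [← eventually_add_mul_nonpos_iff, ← eventually_add_mul_nonpos_iff,
    ← eventually_add_mul_nonpos_iff, mem_tangentCone]
  simp only [mem_tangentCone_cornerTriangle hd, eventually_and, eventually_or_distrib_left,
    eventually_const, Pi.add_apply, Pi.smul_apply, smul_eq_mul]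
  refine and_congr Iff.rfl (and_congr Iff.rfl (or_congr Iff.rfl (and_congr Iff.rfl
    (eventually_congr (Eventually.of_forall fun ε => ?_)))))
  ring_nf

/-- The flags along the edges of `cornerTriangle d s`, based at a vertex of the edge and with the
side facing outwards. -/
def cornerFlags (s : ℤ) : Finset Flag :=
  {(![s, 1], ![0, -1], 1), (![s - 1, 1], ![1, 0], 1), (![s, 0], ![-1, 1], 1),
    (![s, 0], ![0, 1], -1), (![s, 1], ![-1, 0], -1), (![s - 1, 1], ![1, -1], -1)}

theorem flagJump_cornerTriangle {d : ℕ} (hd : 0 < d) (s : ℤ) (a : Flag)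
    (ha : IsCoprime (a.2.1 0) (a.2.1 1)) :
    flagJump d (cornerTriangle d s) a = if a ∈ cornerFlags s then 1 else 0 := by
  obtain ⟨z, w, σ⟩ := a
  simp only at ha
  -- A primitive vector parallel to an edge is one of two.
  have u0 : w 0 = 0 → w 1 = 1 ∨ w 1 = -1 := fun h => by
    rw [h, isCoprime_zero_left] at ha
    exact Int.isUnit_iff.1 ha
  have u1 : w 1 = 0 → w 0 = 1 ∨ w 0 = -1 := fun h => by
    rw [h, isCoprime_zero_right] at ha
    exact Int.isUnit_iff.1 ha
  have u2 : -w 0 - w 1 = 0 → w 0 = 1 ∨ w 0 = -1 := fun h => by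
    rw [show w 1 = -w 0 by omega, IsCoprime.neg_right_iff, isCoprime_self] at ha
    exact Int.isUnit_iff.1 ha
  have h1 : toPlane w ∈ tangentCone (cornerTriangle d s) (latticePoint d z) ↔
      (z 0 - s < 0 ∨ z 0 - s = 0 ∧ w 0 ≤ 0) ∧ (z 1 - 1 < 0 ∨ z 1 - 1 = 0 ∧ w 1 ≤ 0) ∧
        (s - z 0 - z 1 < 0 ∨ s - z 0 - z 1 = 0 ∧ -w 0 - w 1 ≤ 0) := by
    rw [mem_tangentCone_cornerTriangle hd]
    simp only [toPlane]
    norm_cast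
  have h2 : transverse w σ ∈
      tangentCone (tangentCone (cornerTriangle d s) (latticePoint d z)) (toPlane w) ↔
      (z 0 - s < 0 ∨ z 0 - s = 0 ∧ (w 0 < 0 ∨ w 0 = 0 ∧ (σ : ℤ) * -w 1 ≤ 0)) ∧
      (z 1 - 1 < 0 ∨ z 1 - 1 = 0 ∧ (w 1 < 0 ∨ w 1 = 0 ∧ (σ : ℤ) * w 0 ≤ 0)) ∧
      (s - z 0 - z 1 < 0 ∨ s - z 0 - z 1 = 0 ∧
        (-w 0 - w 1 < 0 ∨ -w 0 - w 1 = 0 ∧ -((σ : ℤ) * -w 1) - (σ : ℤ) * w 0 ≤ 0)) := by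
    rw [mem_tangentCone_tangentCone_cornerTriangle hd]
    simp only [toPlane, transverse, Pi.smul_apply, smul_eq_mul, Matrix.cons_val_zero,
      Matrix.cons_val_one, Matrix.cons_val_fin_one]
    norm_cast
  have hne : (1 : ℤˣ) ≠ -1 := by decide
  have h3 : (z, w, σ) ∈ cornerFlags s ↔
      (σ = 1 ∧ (z 0 = s ∧ z 1 = 1 ∧ w 0 = 0 ∧ w 1 = -1 ∨
        z 0 = s - 1 ∧ z 1 = 1 ∧ w 0 = 1 ∧ w 1 = 0 ∨ z 0 = s ∧ z 1 = 0 ∧ w 0 = -1 ∧ w 1 = 1)) ∨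
      (σ = -1 ∧ (z 0 = s ∧ z 1 = 0 ∧ w 0 = 0 ∧ w 1 = 1 ∨
        z 0 = s ∧ z 1 = 1 ∧ w 0 = -1 ∧ w 1 = 0 ∨
        z 0 = s - 1 ∧ z 1 = 1 ∧ w 0 = 1 ∧ w 1 = -1)) := by
    rcases Int.units_eq_one_or σ with rfl | rfl <;>
      simp only [cornerFlags, Finset.mem_insert, Finset.mem_singleton, Prod.mk.injEq, funext_iff,
        Fin.forall_fin_two, Matrix.cons_val_zero, Matrix.cons_val_one, Matrix.cons_val_fin_one,
        hne, hne.symm, and_true, and_false, or_false, false_or, true_and, false_and, and_assoc]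
  have h4 : (z, w, σ) ∈ cornerFlags s ↔
      toPlane w ∈ tangentCone (cornerTriangle d s) (latticePoint d z) ∧ ¬ transverse w σ ∈
        tangentCone (tangentCone (cornerTriangle d s) (latticePoint d z)) (toPlane w) := by
    rw [h1, h2, h3]
    rcases Int.units_eq_one_or σ with rfl | rfl
    · simp only [hne, true_and, false_and, or_false, Units.val_one, one_mul]
      omega
    · simp only [hne.symm, true_and, false_and, false_or, Units.val_neg, Units.val_one, neg_mul,
        one_mul]
      omega
  -- The triangle is closed, so no jump is -1.
  have h5 : transverse w σ ∈
      tangentCone (tangentCone (cornerTriangle d s) (latticePoint d z)) (toPlane w) →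
      toPlane w ∈ tangentCone (cornerTriangle d s) (latticePoint d z) := by
    rw [h1, h2]
    omega
  by_cases c1 : toPlane w ∈ tangentCone (cornerTriangle d s) (latticePoint d z) <;>
    by_cases c2 : transverse w σ ∈
      tangentCone (tangentCone (cornerTriangle d s) (latticePoint d z)) (toPlane w)
  · simp [flagJump, c1, c2, mt h4.1 fun h => h.2 c2]
  · simp [flagJump, c1, c2, h4.2 ⟨c1, c2⟩]
  · exact absurd (h5 c2) c1
  · simp [flagJump, c1, c2, mt h4.1 fun h => c1 h.1]

/-- The two flags of an edge have opposite directions and opposite signs σ, hence equal weights;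
this gives the factor 2. -/
theorem flagSum_cornerTriangle {d : ℕ} (hd : 0 < d) (φ : ZMod d → ℤ) (s : ℤ) :
    flagSum d φ (cornerTriangle d s) = 2 * (φ s + φ (-s) + φ (-1)) := by
  have hterm : ∀ a, flagTerm d φ (cornerTriangle d s) a = if a ∈ cornerFlags s then
      φ (((a.2.2 : ℤ) * cross a.1 a.2.1 : ℤ) : ZMod d) else 0 := by
    intro a
    unfold flagTerm
    by_cases ha : IsCoprime (a.2.1 0) (a.2.1 1)
    · rw [if_pos ha, flagJump_cornerTriangle hd s a ha, mul_ite, mul_one, mul_zero]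
    · rw [if_neg ha, if_neg]
      intro h
      apply ha
      simp only [cornerFlags, Finset.mem_insert, Finset.mem_singleton] at h
      rcases h with rfl | rfl | rfl | rfl | rfl | rfl <;>
        simp [isCoprime_zero_left, isCoprime_zero_right, isCoprime_one_left, isCoprime_one_right]
  unfold flagSum
  rw [finsum_congr hterm, finsum_eq_finsetSum_of_support_subset (s := cornerFlags s),
    Finset.sum_ite_mem, Finset.inter_self]
  · unfold cornerFlags
    rw [Finset.sum_insert, Finset.sum_insert, Finset.sum_insert, Finset.sum_insert,
      Finset.sum_insert, Finset.sum_singleton] <;> simp [cross]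
    ring
  · intro a ha
    by_contra h
    exact ha (if_neg h)

theorem not_equidecomposable_of_gEquivalent {d : ℕ} (hd : 0 < d) {s s' : ℤ} {T T' : Set Plane}
    (h : GEquivalent T (cornerTriangle d s)) (h' : GEquivalent T' (cornerTriangle d s'))
    (h1 : (s : ZMod d) ≠ s') (h2 : (s : ZMod d) ≠ -s') : ¬ Equidecomposable T T' := by
  intro he
  obtain ⟨g, hg, hT⟩ := h
  obtain ⟨g', hg', hT'⟩ := h'
  classical
  -- The φ(-1) terms agree on both sides, while φ(s) = 1 occurs only on the side of s.
  have := he.flagSum_eq hd fun x => if x = s then 1 else 0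
  rw [← flagSum_image hd _ hg T, ← flagSum_image hd _ hg' T', hT, hT', flagSum_cornerTriangle hd,
    flagSum_cornerTriangle hd, if_pos rfl, if_neg h1.symm, if_neg h2.symm] at this
  split_ifs at this <;> omega

/-! ### Existence for every odd d > 3, with t = 0 -/

theorem exists_areSimilarNeighbors {d : ℕ} (hodd : IsCoprime 2 (d : ℤ)) (hd : 3 < d) :
    AreSimilarNeighbors d 0 (leftTriangle d 0) (rightTriangle d 0) := by
  have hpos : 0 < d := by omega
  have hid : IsGMap id := ⟨1, 0, by
    ext1 x
    simp [affineUnimodular, Pi.zero_def]⟩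
  refine ⟨hpos, ?_, ?_, ⟨id, hid, Set.image_id _⟩, ⟨id, hid, Set.image_id _⟩, ?_, ?_, ?_, ?_⟩
  · rw [leftTriangle_eq hpos]
    exact isMinimalTriangle_cornerTriangle hpos _
  · rw [rightTriangle_eq hpos]
    exact isMinimalTriangle_cornerTriangle hpos _
  · exact isCoprime_one_left
  · exact isCoprime_one_left
  · simpa using hodd
  · intro h
    have := Int.le_of_dvd (by norm_num) (Int.modEq_zero_iff_dvd.1 h)
    omega

theorem infinite_setOf_areSimilarNeighbors :
    Set.Infinite {d : ℕ | ∃ (t : ℤ) (Tl Tr : Set Plane), AreSimilarNeighbors d t Tl Tr} := by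
  refine Set.infinite_of_injective_forall_mem (f := fun n : ℕ => 2 * n + 5)
    (fun a b h => by simpa using h) fun n => ⟨0, _, _, exists_areSimilarNeighbors ?_ (by omega)⟩
  exact ⟨-(n + 2), 1, by push_cast; ring⟩

end DiscreteEquidecomp

open DiscreteEquidecomp
theorem mainTheorem3 :
    (∀ (d : ℕ) (t : ℤ) (Tl Tr : Set Plane), AreSimilarNeighbors d t Tl Tr →
      IsQuasiPolynomial d (fun k => (ehr Tl k : ℝ)) ∧
      (∀ k : ℕ, ehr Tl k = ehr Tr k) ∧
      (∀ W : Multiset (ZMod d),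
        HasWeight d Tl W ↔ W = {(1 + t : ZMod d), 1, (-1 - t : ZMod d)}) ∧
      (∀ W : Multiset (ZMod d),
        HasWeight d Tr W ↔ W = {(2 + t : ZMod d), 1, (-2 - t : ZMod d)}) ∧
      ({(1 + t : ZMod d), 1, (-1 - t : ZMod d)} : Multiset (ZMod d)) ≠
        {(2 + t : ZMod d), 1, (-2 - t : ZMod d)} ∧
      ¬ Equidecomposable Tl Tr) ∧
    Set.Infinite {d : ℕ | ∃ (t : ℤ) (Tl Tr : Set Plane), AreSimilarNeighbors d t Tl Tr} := by
  refine ⟨fun d t Tl Tr h => ?_, infinite_setOf_areSimilarNeighbors⟩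
  have hd := h.pos
  have hl := h.left_equiv
  have hr := h.right_equiv
  rw [leftTriangle_eq hd] at hl
  rw [rightTriangle_eq hd] at hr
  have hne : (3 + 2 * t : ZMod d) ≠ 0 := fun h0 => by
    apply h.not_zero_mod
    rw [← ZMod.intCast_eq_intCast_iff]
    push_cast
    exact h0
  -- Equality would make `ZMod d` trivial, so 3 + 2t would vanish as well.
  have hne1 : (1 + t : ZMod d) ≠ 2 + t := fun h0 => hne (by
    linear_combination (-(3 + 2 * t) : ZMod d) * h0)
  have hne2 : (1 + t : ZMod d) ≠ -(2 + t) := fun h0 => hne (by linear_combination h0)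
  have hnot := not_equidecomposable_of_gEquivalent hd hl hr (by push_cast; exact hne1)
    (by push_cast; exact hne2)
  obtain ⟨gl, hgl, hTl⟩ := hl
  obtain ⟨gr, hgr, hTr⟩ := hr
  have el : ∀ k, ehr Tl k = ehr (cornerTriangle d (1 + t)) k := fun k => by
    rw [← hTl, ehr_image hgl]
  have er : ∀ k, ehr Tr k = ehr (cornerTriangle d (2 + t)) k := fun k => by
    rw [← hTr, ehr_image hgr]
  refine ⟨?_, fun k => ?_, fun W => ?_, fun W => ?_, fun heq => ?_, hnot⟩
  · simp only [el]
    exact isQuasiPolynomial_ehr_cornerTriangle hd h.coprime_left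
  · rw [el, er, ehr_cornerTriangle hd h.coprime_left, ehr_cornerTriangle hd h.coprime_right]
  · rw [← hasWeight_image_iff hd hgl, hTl, hasWeight_cornerTriangle_iff hd,
      show (-1 - t : ZMod d) = -(1 + t) by ring]
    push_cast
    rfl
  · rw [← hasWeight_image_iff hd hgr, hTr, hasWeight_cornerTriangle_iff hd,
      show (-2 - t : ZMod d) = -(2 + t) by ring]
    push_cast
    rfl
  · simp only [Multiset.insert_eq_cons] at heq
    -- Cancel the common entry 1; then 1 + t would have to be 2 + t or -(2 + t).
    rw [Multiset.cons_swap, Multiset.cons_swap (2 + t : ZMod d), Multiset.cons_inj_right] at heq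
    have hm : (1 + t : ZMod d) ∈ ((2 + t : ZMod d) ::ₘ {(-2 - t : ZMod d)}) := by
      rw [← heq]
      exact Multiset.mem_cons_self _ _
    rw [Multiset.mem_cons, Multiset.mem_singleton] at hm
    rcases hm with hm | hm
    · exact hne1 hm
    · exact hne2 (by rw [hm]; ring)
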